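/- **Setting.** Let $T\subset\mathbb C$ be open. For $t\in T$ consider a $3\times 3$ equation $\frac{d\Psi}{d\lambda}=A(\lambda;t)\Psi$ with $A$ rational in $\lambda$, $A(\lambda;t)=B(\lambda;t)+\frac{A_t}{\lambda-t}$, $B$ regular at $\lambda=t$, and a fundamental solution $\Psi(\lambda,t)$ which near $\lambda=t$ has the expansion $$\Psi=\Big(\sum_{k\ge 0}\psi_k(t)(\lambda-t)^k\Big)\,\mathrm{diag}\Big(\lambda-t,\,1,\,\frac1{\lambda-t}\Big)\,(\lambda-t)^{\Xi}\,C(t),\qquad \Xi=\begin{pmatrix}0&\kappa_2&\kappa_1\\0&0&\kappa_3\\0&0&0\end{pmatrix},$$ where $\det C=\det\psi_0=1$, $\kappa_1,\kappa_2,\kappa_3$ do not depend on $t$, the function $C$ is holomorphic in $t$, the series is convergent for $\lambda$ near $t$ with sum holomorphic in $(\lambda,t)$, and $A_t=\psi_0\,\mathrm{diag}(1,0,-1)\,\psi_0^{-1}$. Put $Q=C'(t)C^{-1}(t)$ and $\nu=Q_{31}$. Suppose that at some $t\in T$ the isomonodromy condition $[Q,e^{2\pi i\Xi}]=0$ holds.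 **Claim.** 1. If $Q_{31}\ne0$, or $Q_{31}=0$ and $Q_{21}Q_{32}\neq0$ (at this $t$), then $\Xi=0$. Moreover, for every $s\in T$ the Fuchsian singularity $\lambda=s$ of the equation with coefficient matrix $A(\lambda;s)$ can be removed by a Schlesinger transformation: there is a matrix $R(\lambda)$, rational in $\lambda$, with $\det R=1$ and without poles in $\mathbb C\setminus\{s\}$, such that $\Phi=R\Psi$ satisfies $\frac{d\Phi}{d\lambda}=\hat A(\lambda)\Phi$, where the rational matrix $\hat A=(R'+RA)R^{-1}$ is regular at $\lambda=s$ and has at every other finite point a pole of the same order as $A(\lambda;s)$ (order $0$ meaning that there is no pole). 2. If $Q_{31}=0$, $Q_{32}=0$ and $Q_{21}\neq0$, then $\kappa_2=0$. 3. If $Q_{31}=0$, $Q_{21}=0$ and $Q_{32}\neq0$, then $\kappa_3=0$. 4. If, at this $t$, $\Psi$ satisfies the non-Schlesinger deformation equation $$\frac{d\Psi}{dt}=-\frac{A_t+\Lambda}{\lambda-t}\Psi,\qquad \Lambda=\psi_0\begin{pmatrix}0&0&0\\ \mu_1&0&0\\0&\mu_2&0\end{pmatrix}\psi_0^{-1}$$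 for $\lambda$ near $t$, then $\nu=Q_{31}=0$, $Q_{21}=-\mu_1$ and $Q_{32}=-\mu_2$. Thus for these deformations $\mu_1\mu_2=Q_{21}Q_{32}$, and parts 1, 2 and 3 say: $\mu_1\mu_2\ne0$ implies $\Xi=0$ and removability of the singularity; $\mu_2=0$, $\mu_1\neq0$ imply $\kappa_2=0$; $\mu_1=0$, $\mu_2\neq0$ imply $\kappa_3=0$. -/

import Mathlib

open Filter Topology

namespace NonSchlesinger

/-- Complex `3 × 3` matrices. -/
abbrev Mat3 := Matrix (Fin 3) (Fin 3) ℂ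

/-- `3 × 3` matrices whose entries are rational functions of `λ` (the variable is `RatFunc.X`). -/
abbrev RatMat3 := Matrix (Fin 3) (Fin 3) (RatFunc ℂ)

/-! ### Rational matrices: value, derivative, regularity, order of a pole -/

/-- The value at `z` of a matrix of rational functions (meaningful when `z` is not a pole). -/
noncomputable def evalAt (z : ℂ) (F : RatMat3) : Mat3 :=
  F.map (RatFunc.eval (RingHom.id ℂ) z)

/-- The derivative `d/dλ` of a rational function, by the quotient rule. -/
noncomputable def ratDeriv (f : RatFunc ℂ) : RatFunc ℂ :=
  algebraMap (Polynomial ℂ) (RatFunc ℂ)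
      (Polynomial.derivative f.num * f.denom - f.num * Polynomial.derivative f.denom) /
    algebraMap (Polynomial ℂ) (RatFunc ℂ) f.denom ^ 2

/-- No entry of `F` has a pole at the finite point `z`. -/
def RegularAt (z : ℂ) (F : RatMat3) : Prop :=
  ∀ i j, (F i j).denom.eval z ≠ 0

/-- The order of the pole of `F` at the finite point `z` (it is `0` if `F` is regular there):
the least `k` such that `(λ - z) ^ k F` is regular at `z`. -/
noncomputable def poleOrder (z : ℂ) (F : RatMat3) : ℕ :=
  sInf {k : ℕ | RegularAt z ((RatFunc.X - RatFunc.C z) ^ k • F)}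

/-- `F = B + A_t / (λ - t)` with `B` regular at `λ = t`. -/
def HasFuchsianPole (F : RatMat3) (t : ℂ) (At : Mat3) : Prop :=
  ∃ B : RatMat3, RegularAt t B ∧
    F = B + (RatFunc.X - RatFunc.C t)⁻¹ • At.map RatFunc.C

/-! ### Schlesinger transformations -/

/-- `Φ = R(λ) Ψ` is a Schlesinger transformation at the finite point `t`: the matrix `R` is rational
with determinant one and has no pole at any finite point other than `t`. -/
def IsSchlesinger (t : ℂ) (R : RatMat3) : Prop :=
  R.det = 1 ∧ ∀ z, z ≠ t → RegularAt z R

/-- The coefficient matrix of the equation satisfied by `Φ = R Ψ` when `dΨ/dλ = F Ψ`. -/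
noncomputable def transformed (R F : RatMat3) : RatMat3 :=
  (R.map ratDeriv + R * F) * R⁻¹

/-! ### Local solutions near `λ = t` -/

/-- The points `λ` with `λ - t` in the plane cut along the negative half-line. -/
def cutPlane (t : ℂ) : Set ℂ := {z | z - t ∈ Complex.slitPlane}

/-- `Ψ` solves `dΨ/dλ = F Ψ` near `λ = t` (in a cut neighbourhood). -/
def SolvesNear (F : RatMat3) (t : ℂ) (Ψ : ℂ → Mat3) : Prop :=
  ∀ᶠ z in 𝓝[cutPlane t] t, ∀ i j,
    HasDerivAt (fun w => Ψ w i j) ((evalAt z F * Ψ z) i j) z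

/-- The diagonal matrix of the eigenvalues `1, 0, -1`. -/
def expo : Mat3 := Matrix.diagonal ![1, 0, -1]

/-- The nilpotent log-matrix `Ξ`. -/
def Xi (κ₁ κ₂ κ₃ : ℂ) : Mat3 := !![0, κ₂, κ₁; 0, 0, κ₃; 0, 0, 0]

/-- The sum `∑ ψ_k(s) (z - s) ^ k` of the power series part. -/
noncomputable def seriesSum (ψ : ℂ → ℕ → Mat3) (s z : ℂ) : Mat3 :=
  ∑' k : ℕ, (z - s) ^ k • ψ s k

/-- Near the point `(t, t)` of the space of pairs `(s, z)` (`s` the deformation parameter, `z` the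
value of `λ`), the power series converges to a function that is holomorphic in `(s, z)`, and
`Ψ(z, s) = (∑ ψ_k(s) (z-s)^k) diag(z-s, 1, 1/(z-s)) (z-s)^Ξ C(s)`
for the principal branch of `log (z - s)`. The first argument of `Ψ` is `s`, the second is `z`. -/
def HasExpansionNear (Ψ : ℂ → ℂ → Mat3) (ψ : ℂ → ℕ → Mat3) (Ξ : Mat3) (C : ℂ → Mat3)
    (t : ℂ) : Prop :=
  (∀ i j, AnalyticAt ℂ (fun p : ℂ × ℂ => seriesSum ψ p.1 p.2 i j) (t, t)) ∧
  ∀ᶠ p : ℂ × ℂ in 𝓝 (t, t),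
    Summable (fun k : ℕ => (p.2 - p.1) ^ k • ψ p.1 k) ∧
    (p.2 ∈ cutPlane p.1 →
      Ψ p.1 p.2 = seriesSum ψ p.1 p.2 *
        Matrix.diagonal ![p.2 - p.1, 1, (p.2 - p.1)⁻¹] *
        NormedSpace.exp (Complex.log (p.2 - p.1) • Ξ) * C p.1)

/-! ### The deformation with respect to `t` -/

/-- `Q = C' C⁻¹`. -/
noncomputable def Qmat (C : ℂ → Mat3) (t : ℂ) : Mat3 :=
  (Matrix.of fun i j => deriv (fun s => C s i j) t) * (C t)⁻¹

/-- The isomonodromy condition `[Q, e^{2πiΞ}] = 0` at `t`. -/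
def IsomonodromyCondition (C : ℂ → Mat3) (Ξ : Mat3) (t : ℂ) : Prop :=
  ⁅Qmat C t, NormedSpace.exp ((2 * (Real.pi : ℂ) * Complex.I) • Ξ)⁆ = 0

/-- `Λ = ψ₀ (μ₁ E₂₁ + μ₂ E₃₂) ψ₀⁻¹`. -/
noncomputable def Lam (ψ₀ : Mat3) (μ₁ μ₂ : ℂ) : Mat3 :=
  ψ₀ * !![0, 0, 0; μ₁, 0, 0; 0, μ₂, 0] * ψ₀⁻¹

/-- `dΨ/dt = - (A_t + Λ) / (λ - t) Ψ` at the parameter value `t`, for `λ` near `t`. -/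
def SatisfiesDeformation (Ψ : ℂ → ℂ → Mat3) (t : ℂ) (At Λ : Mat3) : Prop :=
  ∀ᶠ z in 𝓝[cutPlane t] t, ∀ i j,
    HasDerivAt (fun s => Ψ s z i j) ((-((z - t)⁻¹ • (At + Λ)) * Ψ t z) i j) t

end NonSchlesinger

open NonSchlesinger

/-!
Write `u = λ - t` and `D = diag(u, 1, 1/u)`, and let `P` be the sum of the power series part.

*The conditions on `Ξ`.* Since `Ξ` is nilpotent, it is a polynomial in the unipotent matrix
`e^{2πiΞ}`, so the isomonodromy condition says that `Q` commutes with `Ξ` itself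
(`IsomonodromyCondition.commute`). Comparing entries of `QΞ = ΞQ` gives all the conclusions about
`κ₁, κ₂, κ₃` (`entries_of_commute_Xi`, `Xi_eq_zero_of_commute`).

*Removing the singularity.* If `Ξ = 0`, the solution near `s` is `P D C` with `P` holomorphic and
invertible. The lattice spanned by the columns of `P(s)⁻¹ P D` over the holomorphic germs is also
spanned by `u e₁`, `e₂` and `e₃ / u + a e₁` for a suitable constant `a`. The inverse of the matrix
of these vectors, times `P(s)⁻¹`, is a rational matrix `R` of determinant one for which `R P D` is
holomorphic and invertible at `s` (`exists_removing_schlesinger`). With `K = R P D C` the new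
coefficient matrix equals `K' K⁻¹` near `s`, hence stays bounded there, and a bounded rational
function has no pole (`regularAt_transformed`). At the other finite points `R` and `R⁻¹` are
regular, so orders of poles are kept (`poleOrder_transformed`).

*The deformation equation.* Because `Q` commutes with `Ξ`, the logarithmic factor cancels when the
expansion is differentiated with respect to `t`, and the equation becomes a formula for
`u D Q D⁻¹` (`conjugated_deformation`), whose limit for `u → 0` is `-(μ₁ E₂₁ + μ₂ E₃₂)`. The entries
of `u D Q D⁻¹` at the places `(3,1)`, `(2,1)`, `(3,2)` are `Q₃₁ / u`, `Q₂₁`, `Q₃₂`, which determines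
these entries of `Q` (`Qmat_entries_of_deformation`).
-/

namespace NonSchlesinger

/-! ### The exponential of `x Ξ` and the commutation relations -/

theorem Xi_pow_three (κ₁ κ₂ κ₃ : ℂ) : Xi κ₁ κ₂ κ₃ ^ 3 = 0 := by
  ext i j
  fin_cases i <;> fin_cases j <;>
    simp [Xi, pow_succ, Matrix.mul_apply, Fin.sum_univ_three]

theorem exp_smul_Xi (κ₁ κ₂ κ₃ x : ℂ) :
    NormedSpace.exp (x • Xi κ₁ κ₂ κ₃) =
      1 + x • Xi κ₁ κ₂ κ₃ + (x ^ 2 / 2) • Xi κ₁ κ₂ κ₃ ^ 2 := by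
  have h0 : ∀ n ∉ Finset.range 3,
      ((n.factorial : ℂ)⁻¹) • (x • Xi κ₁ κ₂ κ₃) ^ n = 0 := by
    intro n hn
    obtain ⟨m, rfl⟩ := Nat.exists_eq_add_of_le (Nat.le_of_not_lt (Finset.mem_range.not.mp hn))
    rw [pow_add, smul_pow, Xi_pow_three]
    simp
  rw [NormedSpace.exp_eq_tsum ℂ]
  beta_reduce
  rw [tsum_eq_sum h0]
  simp only [Finset.sum_range_succ, Finset.sum_range_zero, smul_pow, smul_smul]
  simp [Nat.factorial, div_eq_inv_mul]

/-- As `Ξ` is nilpotent, it is a polynomial in the unipotent monodromy matrix `e^{2πiΞ}`; what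
commutes with the monodromy therefore commutes with `Ξ` itself. -/
theorem IsomonodromyCondition.commute {C : ℂ → Mat3} {κ₁ κ₂ κ₃ t : ℂ}
    (h : IsomonodromyCondition C (Xi κ₁ κ₂ κ₃) t) : Commute (Qmat C t) (Xi κ₁ κ₂ κ₃) := by
  rw [IsomonodromyCondition, ← commute_iff_lie_eq] at h
  set τ : ℂ := 2 * (Real.pi : ℂ) * Complex.I with hτ
  have hτ0 : τ ≠ 0 := Complex.two_pi_I_ne_zero
  set X := Xi κ₁ κ₂ κ₃ with hX
  have h3 : X ^ 3 = 0 := Xi_pow_three _ _ _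
  set M := NormedSpace.exp (τ • X) with hM
  have hM' : M - 1 = τ • X + (τ ^ 2 / 2) • X ^ 2 := by
    rw [hM, hX, exp_smul_Xi]; abel
  have hsq : (M - 1) ^ 2 = τ ^ 2 • X ^ 2 := by
    have h4 : X ^ 4 = 0 := by rw [pow_succ, h3, zero_mul]
    rw [hM', sq]
    simp only [add_mul, mul_add, smul_mul_smul_comm, ← pow_succ, ← pow_succ', ← pow_add]
    norm_num [h3, h4, ← sq]
  have key : X = τ⁻¹ • ((M - 1) - (1 / 2 : ℂ) • (M - 1) ^ 2) := by
    rw [hsq, hM', smul_smul, show (1 / 2 : ℂ) * τ ^ 2 = τ ^ 2 / 2 by ring, add_sub_cancel_right,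
      smul_smul, inv_mul_cancel₀ hτ0, one_smul]
  have h1 : Commute (Qmat C t) (M - 1) := h.sub_right (Commute.one_right _)
  rw [key]
  exact (h1.sub_right ((h1.pow_right 2).smul_right _)).smul_right _

/-- The entries of `[Q, Ξ] = 0` that carry the conclusions about `κ₁, κ₂, κ₃`. -/
theorem entries_of_commute_Xi {Q : Mat3} {κ₁ κ₂ κ₃ : ℂ} (h : Commute Q (Xi κ₁ κ₂ κ₃)) :
    κ₂ * Q 2 0 = 0 ∧ κ₃ * Q 2 0 = 0 ∧ κ₁ * Q 2 0 + κ₃ * Q 2 1 = 0 ∧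
      κ₂ * Q 1 0 + κ₁ * Q 2 0 = 0 ∧ κ₂ * Q 0 0 = κ₂ * Q 1 1 + κ₁ * Q 2 1 := by
  have e : ∀ i j, (Q * Xi κ₁ κ₂ κ₃) i j = (Xi κ₁ κ₂ κ₃ * Q) i j := fun i j => by rw [h.eq]
  have e00 := e 0 0
  have e01 := e 0 1
  have e10 := e 1 0
  have e21 := e 2 1
  have e22 := e 2 2
  simp [Xi, Matrix.mul_apply, Fin.sum_univ_three] at e00 e01 e10 e21 e22
  refine ⟨?_, ?_, ?_, ?_, ?_⟩
  · rcases e21 with h | h <;> simp [h]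
  · rcases e10 with h | h <;> simp [h]
  · linear_combination e22
  · linear_combination -e00
  · linear_combination e01

theorem Xi_eq_zero_of_commute {Q : Mat3} {κ₁ κ₂ κ₃ : ℂ} (h : Commute Q (Xi κ₁ κ₂ κ₃))
    (hQ : Q 2 0 ≠ 0 ∨ (Q 2 0 = 0 ∧ Q 1 0 * Q 2 1 ≠ 0)) : Xi κ₁ κ₂ κ₃ = 0 := by
  obtain ⟨h1, h2, h3, h4, h5⟩ := entries_of_commute_Xi h
  have hκ : κ₁ = 0 ∧ κ₂ = 0 ∧ κ₃ = 0 := by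
    rcases hQ with hQ | ⟨hQ, hQ'⟩
    · have k2 := (mul_eq_zero.mp h1).resolve_right hQ
      have k3 := (mul_eq_zero.mp h2).resolve_right hQ
      simp only [k3, zero_mul, add_zero] at h3
      exact ⟨(mul_eq_zero.mp h3).resolve_right hQ, k2, k3⟩
    · simp only [hQ, mul_zero, zero_add, add_zero] at h3 h4
      have k2 := (mul_eq_zero.mp h4).resolve_right (left_ne_zero_of_mul hQ')
      have k3 := (mul_eq_zero.mp h3).resolve_right (right_ne_zero_of_mul hQ')
      simp only [k2, zero_mul, zero_add] at h5
      exact ⟨(mul_eq_zero.mp h5.symm).resolve_right (right_ne_zero_of_mul hQ'), k2, k3⟩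
  obtain ⟨rfl, rfl, rfl⟩ := hκ
  ext i j
  fin_cases i <;> fin_cases j <;> simp [Xi]

/-! ### Rational functions regular at a point -/

/-- The ring of rational functions without a pole at `z`. -/
def regularSubring (z : ℂ) : Subring (RatFunc ℂ) where
  carrier := {f | f.denom.eval z ≠ 0}
  mul_mem' {a b} ha hb h := by
    have := Polynomial.eval_eq_zero_of_dvd_of_eval_eq_zero (RatFunc.denom_mul_dvd a b) h
    rw [Polynomial.eval_mul] at this
    exact mul_ne_zero ha hb this
  add_mem' {a b} ha hb h := by
    have := Polynomial.eval_eq_zero_of_dvd_of_eval_eq_zero (RatFunc.denom_add_dvd a b) h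
    rw [Polynomial.eval_mul] at this
    exact mul_ne_zero ha hb this
  one_mem' := by simp
  zero_mem' := by simp
  neg_mem' {a} ha h := by
    have h1 : (-a).denom ∣ a.denom := by
      rw [RatFunc.denom_dvd a.denom_ne_zero]
      exact ⟨-a.num, by rw [map_neg, neg_div, RatFunc.num_div_denom]⟩
    exact ha (Polynomial.eval_eq_zero_of_dvd_of_eval_eq_zero h1 h)

theorem mem_regularSubring {z : ℂ} {f : RatFunc ℂ} :
    f ∈ regularSubring z ↔ f.denom.eval z ≠ 0 := Iff.rfl

theorem C_mem_regularSubring (z a : ℂ) : RatFunc.C a ∈ regularSubring z := by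
  simp [mem_regularSubring]

theorem div_mem_regularSubring {z : ℂ} (p : Polynomial ℂ) {q : Polynomial ℂ} (hq : q.eval z ≠ 0) :
    algebraMap (Polynomial ℂ) (RatFunc ℂ) p / algebraMap (Polynomial ℂ) (RatFunc ℂ) q ∈
      regularSubring z := fun h =>
  hq (Polynomial.eval_eq_zero_of_dvd_of_eval_eq_zero (RatFunc.denom_div_dvd p q) h)

theorem eval_add_of_regular {z : ℂ} {f g : RatFunc ℂ} (hf : f ∈ regularSubring z)
    (hg : g ∈ regularSubring z) :
    (f + g).eval (RingHom.id ℂ) z = f.eval (RingHom.id ℂ) z + g.eval (RingHom.id ℂ) z :=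
  RatFunc.eval_add _ _ hf hg

theorem eval_mul_of_regular {z : ℂ} {f g : RatFunc ℂ} (hf : f ∈ regularSubring z)
    (hg : g ∈ regularSubring z) :
    (f * g).eval (RingHom.id ℂ) z = f.eval (RingHom.id ℂ) z * g.eval (RingHom.id ℂ) z :=
  RatFunc.eval_mul _ _ hf hg

theorem eval_div_of_ne_zero {z : ℂ} (p : Polynomial ℂ) {q : Polynomial ℂ} (hq : q.eval z ≠ 0) :
    (algebraMap (Polynomial ℂ) (RatFunc ℂ) p / algebraMap (Polynomial ℂ) (RatFunc ℂ) q).eval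
      (RingHom.id ℂ) z = p.eval z / q.eval z := by
  have hq0 : algebraMap (Polynomial ℂ) (RatFunc ℂ) q ≠ 0 := by
    intro h
    rw [map_eq_zero_iff _ (RatFunc.algebraMap_injective ℂ)] at h
    simp [h] at hq
  have hpoly : ∀ r : Polynomial ℂ, algebraMap (Polynomial ℂ) (RatFunc ℂ) r ∈ regularSubring z :=
    fun r => by simp [mem_regularSubring]
  have h := eval_mul_of_regular (div_mem_regularSubring p hq) (hpoly q)
  rw [div_mul_cancel₀ _ hq0, RatFunc.eval_algebraMap, RatFunc.eval_algebraMap] at h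
  rw [eq_div_iff hq]
  simpa [Polynomial.eval₂_id] using h.symm

theorem ratDeriv_mem_regularSubring {z : ℂ} {f : RatFunc ℂ} (hf : f ∈ regularSubring z) :
    ratDeriv f ∈ regularSubring z := by
  rw [ratDeriv, ← map_pow]
  exact div_mem_regularSubring _ (by simpa [mem_regularSubring] using hf)

theorem hasDerivAt_eval {z : ℂ} {f : RatFunc ℂ} (hf : f ∈ regularSubring z) :
    HasDerivAt (fun w => f.eval (RingHom.id ℂ) w) ((ratDeriv f).eval (RingHom.id ℂ) z) z := by
  rw [ratDeriv, ← map_pow, eval_div_of_ne_zero _ (by simpa [mem_regularSubring] using hf)]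
  have h := (f.num.hasDerivAt z).div (f.denom.hasDerivAt z) hf
  simp only [Polynomial.eval_sub, Polynomial.eval_mul, Polynomial.eval_pow]
  refine h.congr_of_eventuallyEq (Eventually.of_forall fun w => ?_)
  simp [RatFunc.eval, Polynomial.eval₂_id]

theorem eventually_mem_regularSubring (f : RatFunc ℂ) (s : ℂ) :
    ∀ᶠ z in 𝓝[≠] s, f ∈ regularSubring z := by
  have hfin : {z | f.denom.eval z = 0}.Finite := by
    refine (f.denom.roots.toFinset.finite_toSet).subset fun z hz => ?_
    simpa [f.denom_ne_zero] using hz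
  have := (hfin.subset (Set.sdiff_subset (t := {s}))).isClosed.isOpen_compl.mem_nhds
    (x := s) (by simp)
  filter_upwards [nhdsWithin_le_nhds this, self_mem_nhdsWithin] with z h1 h2 h3
  exact h1 ⟨h3, h2⟩

/-- A rational function that tends to a finite limit along some approach to `s` has no pole at
`s`. -/
theorem mem_regularSubring_of_tendsto {s : ℂ} {f : RatFunc ℂ} {l : Filter ℂ} [l.NeBot]
    (hl : l ≤ 𝓝[≠] s) {a : ℂ} (h : Tendsto (fun z => f.eval (RingHom.id ℂ) z) l (𝓝 a)) :
    f ∈ regularSubring s := by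
  intro h0
  have hl' : l ≤ 𝓝 s := hl.trans nhdsWithin_le_nhds
  have hd : Tendsto (fun z => f.denom.eval z) l (𝓝 0) :=
    h0 ▸ (f.denom.continuous.tendsto s).mono_left hl'
  have hn : Tendsto (fun z => f.num.eval z) l (𝓝 (f.num.eval s)) :=
    (f.num.continuous.tendsto s).mono_left hl'
  have hm := h.mul hd
  rw [mul_zero] at hm
  have hn0 : f.num.eval s = 0 := by
    refine tendsto_nhds_unique (hn.congr' ?_) hm
    filter_upwards [hl (eventually_mem_regularSubring f s)] with z hz
    have hz' : f.denom.eval z ≠ 0 := hz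
    simp [RatFunc.eval, Polynomial.eval₂_id, hz']
  obtain ⟨u, v, huv⟩ := f.isCoprime_num_denom
  have := congrArg (Polynomial.eval s) huv
  simp [hn0, h0] at this

/-! ### Matrices of rational functions -/

theorem RegularAt.mul {z : ℂ} {F G : RatMat3} (hF : RegularAt z F) (hG : RegularAt z G) :
    RegularAt z (F * G) := fun i j => by
  rw [← mem_regularSubring, Matrix.mul_apply]
  exact Subring.sum_mem _ fun k _ => Subring.mul_mem _ (hF i k) (hG k j)

theorem RegularAt.add {z : ℂ} {F G : RatMat3} (hF : RegularAt z F) (hG : RegularAt z G) :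
    RegularAt z (F + G) := fun i j => (regularSubring z).add_mem (hF i j) (hG i j)

theorem RegularAt.neg {z : ℂ} {F : RatMat3} (hF : RegularAt z F) :
    RegularAt z (-F) := fun i j => (regularSubring z).neg_mem (hF i j)

theorem RegularAt.smul {z : ℂ} {f : RatFunc ℂ} {F : RatMat3} (hf : f ∈ regularSubring z)
    (hF : RegularAt z F) : RegularAt z (f • F) :=
  fun i j => (regularSubring z).mul_mem hf (hF i j)

theorem RegularAt.map_ratDeriv {z : ℂ} {F : RatMat3} (hF : RegularAt z F) :
    RegularAt z (F.map ratDeriv) := fun i j => ratDeriv_mem_regularSubring (hF i j)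

theorem regularAt_map_C (z : ℂ) (M : Mat3) : RegularAt z (M.map RatFunc.C) :=
  fun i j => C_mem_regularSubring z (M i j)

theorem evalAt_mul {z : ℂ} {F G : RatMat3} (hF : RegularAt z F) (hG : RegularAt z G) :
    evalAt z (F * G) = evalAt z F * evalAt z G := by
  ext i j
  simp only [evalAt, Matrix.map_apply, Matrix.mul_apply, Fin.sum_univ_three]
  have hm : ∀ k, F i k * G k j ∈ regularSubring z :=
    fun k => Subring.mul_mem _ (hF i k) (hG k j)
  rw [eval_add_of_regular (Subring.add_mem _ (hm 0) (hm 1)) (hm 2),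
    eval_add_of_regular (hm 0) (hm 1)]
  simp only [eval_mul_of_regular (hF i _) (hG _ j)]

theorem evalAt_add {z : ℂ} {F G : RatMat3} (hF : RegularAt z F) (hG : RegularAt z G) :
    evalAt z (F + G) = evalAt z F + evalAt z G := by
  ext i j
  exact eval_add_of_regular (hF i j) (hG i j)

theorem evalAt_map_C (z : ℂ) (M : Mat3) : evalAt z (M.map RatFunc.C) = M := by
  ext i j
  simp [evalAt]

theorem eventually_regularAt (F : RatMat3) (s : ℂ) : ∀ᶠ z in 𝓝[≠] s, RegularAt z F := by
  simp only [RegularAt, eventually_all]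
  exact fun i j => eventually_mem_regularSubring (F i j) s

/-- Conjugation by a matrix that is regular and invertible at `z`, together with a regular additive
term, does not change the order of the pole at `z`. -/
theorem poleOrder_transformed {z : ℂ} {R S F : RatMat3} (hRS : R * S = 1) (hR : RegularAt z R)
    (hS : RegularAt z S) : poleOrder z (transformed R F) = poleOrder z F := by
  have hSR : S * R = 1 := mul_eq_one_comm.mp hRS
  have hinv : R⁻¹ = S := Matrix.inv_eq_right_inv hRS
  have hX : (RatFunc.X - RatFunc.C z : RatFunc ℂ) ∈ regularSubring z :=
    Subring.sub_mem _ (by simp [mem_regularSubring]) (C_mem_regularSubring z z)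
  have hD : RegularAt z (R.map ratDeriv * S) := hR.map_ratDeriv.mul hS
  unfold poleOrder
  congr 1
  ext k
  set f : RatFunc ℂ := (RatFunc.X - RatFunc.C z) ^ k with hf
  have hfm : f ∈ regularSubring z := Subring.pow_mem _ hX k
  have e1 : f • transformed R F = f • (R.map ratDeriv * S) + R * (f • F) * S := by
    rw [transformed, hinv, add_mul, smul_add, Matrix.mul_smul, Matrix.smul_mul]
  have e2 : f • F = S * (f • transformed R F + -(f • (R.map ratDeriv * S))) * R := by
    have h1 : S * (R * (f • F) * S) * R = (S * R) * (f • F) * (S * R) := by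
      simp only [Matrix.mul_assoc]
    rw [e1, add_comm (f • _) (R * _ * S), add_neg_cancel_right, h1, hSR, one_mul, mul_one]
  simp only [Set.mem_ofPred_eq]
  constructor
  · intro h
    rw [e2]
    exact (hS.mul (h.add (RegularAt.smul hfm hD).neg)).mul hR
  · intro h
    rw [e1]
    exact (RegularAt.smul hfm hD).add ((hR.mul h).mul hS)

/-! ### Entrywise calculus of matrix functions -/

theorem hasDerivAt_mul_entries {F G : ℂ → Mat3} {F' G' : Mat3} {z : ℂ}
    (hF : ∀ i j, HasDerivAt (fun w => F w i j) (F' i j) z)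
    (hG : ∀ i j, HasDerivAt (fun w => G w i j) (G' i j) z) (i j : Fin 3) :
    HasDerivAt (fun w => (F w * G w) i j) ((F' * G z + F z * G') i j) z := by
  simp only [Matrix.add_apply, Matrix.mul_apply, ← Finset.sum_add_distrib]
  exact HasDerivAt.fun_sum fun k _ => (hF i k).mul (hG k j)

theorem tendsto_matrix_of_entries {l : Filter ℂ} {F : ℂ → Mat3} {M : Mat3}
    (h : ∀ i j, Tendsto (fun z => F z i j) l (𝓝 (M i j))) : Tendsto F l (𝓝 M) :=
  tendsto_pi_nhds.mpr fun i => tendsto_pi_nhds.mpr fun j => h i j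

theorem tendsto_entry {l : Filter ℂ} {F : ℂ → Mat3} {M : Mat3} (h : Tendsto F l (𝓝 M))
    (i j : Fin 3) : Tendsto (fun z => F z i j) l (𝓝 (M i j)) :=
  tendsto_pi_nhds.mp (tendsto_pi_nhds.mp h i) j

theorem tendsto_inv_of_det_eq_one {l : Filter ℂ} {F : ℂ → Mat3} {M : Mat3}
    (h : Tendsto F l (𝓝 M)) (hM : M.det = 1) :
    Tendsto (fun z => (F z)⁻¹) l (𝓝 M⁻¹) ∧ ∀ᶠ z in l, IsUnit (F z).det := by
  have hM0 : M.det ≠ 0 := by rw [hM]; exact one_ne_zero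
  have hc : ContinuousAt Ring.inverse M.det := by
    have : (Ring.inverse : ℂ → ℂ) = fun x => x⁻¹ := by ext; simp
    rw [this]
    exact continuousAt_inv₀ hM0
  refine ⟨(continuousAt_matrix_inv M hc).tendsto.comp h, ?_⟩
  have hd : Tendsto (fun z => (F z).det) l (𝓝 M.det) :=
    ((continuous_id.matrix_det).tendsto M).comp h
  filter_upwards [hd.eventually_ne hM0] with z hz
  exact isUnit_iff_ne_zero.mpr hz

/-! ### The cut plane -/

theorem cutPlane_subset (s : ℂ) : cutPlane s ⊆ {s}ᶜ := fun z hz h => by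
  rw [Set.mem_singleton_iff] at h
  simp [cutPlane, h] at hz

theorem isOpen_cutPlane (s : ℂ) : IsOpen (cutPlane s) :=
  Complex.isOpen_slitPlane.preimage (continuous_id.sub continuous_const)

instance nhdsWithin_cutPlane_neBot (s : ℂ) : (𝓝[cutPlane s] s).NeBot := by
  have h : Tendsto (fun x : ℝ => s + (x : ℂ)) (𝓝[>] 0) (𝓝[cutPlane s] s) := by
    refine tendsto_nhdsWithin_iff.mpr ⟨?_, ?_⟩
    · have : Continuous fun x : ℝ => s + (x : ℂ) := by fun_prop
      simpa using (this.tendsto 0).mono_left nhdsWithin_le_nhds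
    · filter_upwards [self_mem_nhdsWithin] with x hx
      have hx' : (0 : ℝ) < x := hx
      simp [cutPlane, hx']
  exact h.neBot

/-! ### Removal of the singularity -/

/-- The triangular factor of the transformation removing the singularity, which undoes
`diag(u, 1, 1/u)` (with `u = λ - s`) up to the correction `a`. -/
noncomputable def removalFactor (s a : ℂ) : RatMat3 :=
  !![(RatFunc.X - RatFunc.C s)⁻¹, 0, -RatFunc.C a; 0, 1, 0; 0, 0, RatFunc.X - RatFunc.C s]

/-- The inverse of `removalFactor s a`. -/
noncomputable def removalFactorInv (s a : ℂ) : RatMat3 :=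
  !![RatFunc.X - RatFunc.C s, 0, RatFunc.C a; 0, 1, 0; 0, 0, (RatFunc.X - RatFunc.C s)⁻¹]

theorem X_sub_C_eq_algebraMap (s : ℂ) : (RatFunc.X - RatFunc.C s : RatFunc ℂ) =
    algebraMap (Polynomial ℂ) (RatFunc ℂ) (Polynomial.X - Polynomial.C s) := by
  simp

theorem X_sub_C_ne_zero (s : ℂ) : (RatFunc.X - RatFunc.C s : RatFunc ℂ) ≠ 0 := by
  rw [X_sub_C_eq_algebraMap, Ne, map_eq_zero_iff _ (RatFunc.algebraMap_injective ℂ)]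
  exact Polynomial.X_sub_C_ne_zero s

theorem X_sub_C_mem_regularSubring (z s : ℂ) :
    (RatFunc.X - RatFunc.C s : RatFunc ℂ) ∈ regularSubring z :=
  Subring.sub_mem _ (by simp [mem_regularSubring]) (C_mem_regularSubring z s)

theorem inv_X_sub_C_mem_regularSubring {z s : ℂ} (h : z ≠ s) :
    (RatFunc.X - RatFunc.C s : RatFunc ℂ)⁻¹ ∈ regularSubring z := by
  rw [X_sub_C_eq_algebraMap, ← one_div, ← map_one (algebraMap (Polynomial ℂ) (RatFunc ℂ))]
  exact div_mem_regularSubring _ (by simpa using sub_ne_zero.mpr h)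

theorem eval_X_sub_C (z s : ℂ) :
    (RatFunc.X - RatFunc.C s : RatFunc ℂ).eval (RingHom.id ℂ) z = z - s := by
  rw [X_sub_C_eq_algebraMap, RatFunc.eval_algebraMap]
  simp

theorem eval_inv_X_sub_C {z s : ℂ} (h : z ≠ s) :
    ((RatFunc.X - RatFunc.C s : RatFunc ℂ)⁻¹).eval (RingHom.id ℂ) z = (z - s)⁻¹ := by
  rw [X_sub_C_eq_algebraMap, ← one_div, ← map_one (algebraMap (Polynomial ℂ) (RatFunc ℂ)),
    eval_div_of_ne_zero _ (by simpa using sub_ne_zero.mpr h)]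
  simp

theorem removalFactor_mul_inv (s a : ℂ) : removalFactor s a * removalFactorInv s a = 1 := by
  have h := X_sub_C_ne_zero s
  ext i j
  fin_cases i <;> fin_cases j <;>
    simp [removalFactor, removalFactorInv, Matrix.mul_apply, Fin.sum_univ_three, h, mul_comm]

theorem det_removalFactor (s a : ℂ) : (removalFactor s a).det = 1 := by
  have h := X_sub_C_ne_zero s
  simp [removalFactor, Matrix.det_fin_three, h]

theorem regularAt_removalFactor {z s : ℂ} (a : ℂ) (h : z ≠ s) :
    RegularAt z (removalFactor s a) := fun i j => by
  rw [← mem_regularSubring]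
  fin_cases i <;> fin_cases j <;>
    simp [removalFactor, inv_X_sub_C_mem_regularSubring h, X_sub_C_mem_regularSubring,
      C_mem_regularSubring, -map_neg]

theorem regularAt_removalFactorInv {z s : ℂ} (a : ℂ) (h : z ≠ s) :
    RegularAt z (removalFactorInv s a) := fun i j => by
  rw [← mem_regularSubring]
  fin_cases i <;> fin_cases j <;>
    simp [removalFactorInv, inv_X_sub_C_mem_regularSubring h, X_sub_C_mem_regularSubring,
      C_mem_regularSubring]

theorem evalAt_removalFactor {z s : ℂ} (a : ℂ) (h : z ≠ s) :
    evalAt z (removalFactor s a) = !![(z - s)⁻¹, 0, -a; 0, 1, 0; 0, 0, z - s] := by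
  have hneg : (-RatFunc.C a : RatFunc ℂ) = RatFunc.C (-a) := (map_neg _ _).symm
  ext i j
  fin_cases i <;> fin_cases j <;>
    simp [evalAt, removalFactor, eval_inv_X_sub_C h, eval_X_sub_C, hneg, -map_neg]

/-- If the rational matrix `R` turns a solution into `K`, holomorphic and invertible at `s`, then
the transformed coefficient matrix equals `K' K⁻¹` near `s`. So it tends to a finite limit at `s`
and has no pole there. -/
theorem regularAt_transformed {F R S : RatMat3} {s : ℂ} {Ψ K : ℂ → Mat3}
    (hRS : R * S = 1) (hR : ∀ z, z ≠ s → RegularAt z R) (hS : ∀ z, z ≠ s → RegularAt z S)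
    (hΨ : SolvesNear F s Ψ) (hK : ∀ i j, AnalyticAt ℂ (fun z => K z i j) s)
    (hdet : (K s).det = 1)
    (hRΨ : ∀ᶠ z in 𝓝 s, z ∈ cutPlane s → evalAt z R * Ψ z = K z) :
    RegularAt s (transformed R F) := by
  have hle : 𝓝[cutPlane s] s ≤ 𝓝[≠] s := nhdsWithin_mono _ (cutPlane_subset s)
  have hle' : 𝓝[cutPlane s] s ≤ 𝓝 s := nhdsWithin_le_nhds
  have hinv : R⁻¹ = S := Matrix.inv_eq_right_inv hRS
  have hSR : S * R = 1 := mul_eq_one_comm.mp hRS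
  let K' : ℂ → Mat3 := fun z => Matrix.of fun i j => deriv (fun w => K w i j) z
  have hK't : Tendsto K' (𝓝[cutPlane s] s) (𝓝 (K' s)) :=
    tendsto_matrix_of_entries fun i j => (hK i j).deriv.continuousAt.tendsto.mono_left hle'
  have hKt : Tendsto K (𝓝[cutPlane s] s) (𝓝 (K s)) :=
    tendsto_matrix_of_entries fun i j => (hK i j).continuousAt.tendsto.mono_left hle'
  have hKan : ∀ᶠ z in 𝓝 s, ∀ i j, AnalyticAt ℂ (fun w => K w i j) z := by
    simp only [eventually_all]
    exact fun i j => (hK i j).eventually_analyticAt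
  obtain ⟨hKinv, hKunit⟩ := tendsto_inv_of_det_eq_one hKt hdet
  have key : ∀ᶠ z in 𝓝[cutPlane s] s, evalAt z (transformed R F) = K' z * (K z)⁻¹ := by
    filter_upwards [hle' hKan, hKunit, hΨ, hle (eventually_regularAt F s),
      hle' hRΨ.eventually_nhds, self_mem_nhdsWithin] with z hz hu hsol hF hev hcut
    have hzs : z ≠ s := cutPlane_subset s hcut
    have hRz := hR z hzs
    have hSz := hS z hzs
    have hloc : ∀ᶠ w in 𝓝 z, evalAt w R * Ψ w = K w := by
      filter_upwards [hev, (isOpen_cutPlane s).mem_nhds hcut] with w h1 h2 using h1 h2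
    have hd : K' z = evalAt z (R.map ratDeriv) * Ψ z + evalAt z R * (evalAt z F * Ψ z) := by
      ext i j
      have h1 := hasDerivAt_mul_entries (F := fun w => evalAt w R)
        (F' := evalAt z (R.map ratDeriv)) (G := Ψ)
        (fun i j => hasDerivAt_eval (hRz i j)) hsol i j
      have h2 : HasDerivAt (fun w => (evalAt w R * Ψ w) i j) (K' z i j) z :=
        ((hz i j).differentiableAt.hasDerivAt).congr_of_eventuallyEq
          (hloc.mono fun w hw => congrArg (fun M : Mat3 => M i j) hw)
      exact h2.unique h1
    have hmul : evalAt z (transformed R F) * K z = K' z := by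
      have hone : evalAt z S * evalAt z R = 1 := by
        rw [← evalAt_mul hSz hRz, hSR]
        ext i j
        rw [evalAt, Matrix.map_apply, Matrix.one_apply, Matrix.one_apply]
        split_ifs <;> simp
      rw [transformed, hinv, evalAt_mul (hRz.map_ratDeriv.add (hRz.mul hF)) hSz,
        evalAt_add hRz.map_ratDeriv (hRz.mul hF), evalAt_mul hRz hF, hd, ← hloc.self_of_nhds,
        Matrix.mul_assoc, ← Matrix.mul_assoc (evalAt z S), hone, one_mul, add_mul,
        Matrix.mul_assoc (evalAt z R)]
    rw [← hmul, Matrix.mul_nonsing_inv_cancel_right _ _ hu]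
  have hlim : Tendsto (fun z => evalAt z (transformed R F)) (𝓝[cutPlane s] s)
      (𝓝 (K' s * (K s)⁻¹)) :=
    (hK't.mul hKinv).congr' (key.mono fun z hz => hz.symm)
  exact fun i j => mem_regularSubring_of_tendsto hle (tendsto_entry hlim i j)

theorem exists_analytic_factor {f : ℂ → ℂ} {s : ℂ} (hf : AnalyticAt ℂ f s) (h0 : f s = 0) :
    ∃ g, AnalyticAt ℂ g s ∧ ∀ᶠ z in 𝓝 s, f z = (z - s) * g z := by
  have h : ((1 : ℕ) : ℕ∞) ≤ analyticOrderAt f s := by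
    rw [Nat.cast_one]
    exact Order.one_le_iff_ne_zero.mpr (hf.analyticOrderAt_ne_zero.mpr h0)
  obtain ⟨g, hg, hfg⟩ := (natCast_le_analyticOrderAt hf).mp h
  exact ⟨g, hg, by simpa using hfg⟩

/-- In the absence of logarithms, a Fuchsian singularity with exponents `1, 0, -1` is removed by a
Schlesinger transformation. With `u = λ - s` and the series part `P` normalised to `f = P(s)⁻¹ P`,
a constant `a` is chosen so that the entry `f₁₃ / u² - a f₃₃ / u` of the transformed solution stays
holomorphic. -/
theorem exists_removing_schlesinger {F : RatMat3} {s : ℂ} {Ψ P : ℂ → Mat3} {C₀ : Mat3}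
    (hΨ : SolvesNear F s Ψ) (hP : ∀ i j, AnalyticAt ℂ (fun z => P z i j) s)
    (hdetP : (P s).det = 1) (hC₀ : C₀.det = 1)
    (hexp : ∀ᶠ z in 𝓝 s, z ∈ cutPlane s →
      Ψ z = P z * Matrix.diagonal ![z - s, 1, (z - s)⁻¹] * C₀) :
    ∃ R : RatMat3, IsSchlesinger s R ∧ RegularAt s (transformed R F) ∧
      ∀ z, z ≠ s → poleOrder z (transformed R F) = poleOrder z F := by
  have hPu : IsUnit (P s).det := by rw [hdetP]; exact isUnit_one
  set f : ℂ → Mat3 := fun z => (P s)⁻¹ * P z with hf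
  have hfs : f s = 1 := Matrix.nonsing_inv_mul _ hPu
  have hfan : ∀ i j, AnalyticAt ℂ (fun z => f z i j) s := fun i j => by
    simp only [hf, Matrix.mul_apply]
    exact Finset.analyticAt_fun_sum _ fun k _ => analyticAt_const.mul (hP k j)
  obtain ⟨g, hg, hfg⟩ := exists_analytic_factor (hfan 0 1) (by simp [hfs])
  obtain ⟨k, hk, hfk⟩ := exists_analytic_factor (hfan 1 2) (by simp [hfs])
  obtain ⟨p, hp, hfp⟩ := exists_analytic_factor (hfan 0 2) (by simp [hfs])
  -- as `f₃₃(s) = 1`, this `a` makes `p - a f₃₃` vanish at `s`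
  set a := p s with ha
  obtain ⟨q, hq, hpq⟩ := exists_analytic_factor (f := fun z => p z - a * f z 2 2)
    (hp.sub (analyticAt_const.mul (hfan 2 2))) (by simp [hfs, ha])
  -- the extension over `s` of the transformed solution without its constant factor `C₀`; at `s` it
  -- is upper triangular with units on the diagonal
  let H : ℂ → Mat3 := fun z =>
    !![f z 0 0 - a * (z - s) * f z 2 0, g z - a * f z 2 1, q z;
       (z - s) * f z 1 0, f z 1 1, k z;
       (z - s) ^ 2 * f z 2 0, (z - s) * f z 2 1, f z 2 2]
  have hu : AnalyticAt ℂ (fun z : ℂ => z - s) s := analyticAt_id.sub analyticAt_const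
  have hH : ∀ i j, AnalyticAt ℂ (fun z => H z i j) s := by
    intro i j
    fin_cases i <;> fin_cases j
    · exact (hfan 0 0).sub ((analyticAt_const.mul hu).mul (hfan 2 0))
    · exact hg.sub (analyticAt_const.mul (hfan 2 1))
    · exact hq
    · exact hu.mul (hfan 1 0)
    · exact hfan 1 1
    · exact hk
    · exact (hu.pow 2).mul (hfan 2 0)
    · exact hu.mul (hfan 2 1)
    · exact hfan 2 2
  have hHdet : (H s).det = 1 := by
    simp [H, hfs, Matrix.det_fin_three]
  have hCP : ((P s)⁻¹).map RatFunc.C * (P s).map RatFunc.C = (1 : RatMat3) := by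
    rw [← Matrix.map_mul, Matrix.nonsing_inv_mul _ hPu, Matrix.map_one _ (map_zero _) (map_one _)]
  set R : RatMat3 := removalFactor s a * ((P s)⁻¹).map RatFunc.C with hRdef
  set S : RatMat3 := (P s).map RatFunc.C * removalFactorInv s a with hSdef
  have hRS : R * S = 1 := by
    rw [hRdef, hSdef, Matrix.mul_assoc, ← Matrix.mul_assoc (((P s)⁻¹).map RatFunc.C), hCP, one_mul,
      removalFactor_mul_inv]
  have hR : ∀ z, z ≠ s → RegularAt z R := fun z hz =>
    (regularAt_removalFactor a hz).mul (regularAt_map_C z _)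
  have hS : ∀ z, z ≠ s → RegularAt z S := fun z hz =>
    (regularAt_map_C z _).mul (regularAt_removalFactorInv a hz)
  have hRdet : R.det = 1 := by
    have h1 : (((P s)⁻¹).map RatFunc.C : RatMat3).det = 1 := by
      have : (((P s)⁻¹).map RatFunc.C : RatMat3).det = RatFunc.C ((P s)⁻¹).det :=
        (RingHom.map_det RatFunc.C _).symm
      rw [this, Matrix.det_nonsing_inv, hdetP, Ring.inverse_one, map_one]
    rw [hRdef, Matrix.det_mul, det_removalFactor, h1, one_mul]
  refine ⟨R, ⟨hRdet, hR⟩, ?_, fun z hz => poleOrder_transformed hRS (hR z hz) (hS z hz)⟩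
  refine regularAt_transformed (K := fun z => H z * C₀) hRS hR hS hΨ ?_ ?_ ?_
  · intro i j
    simp only [Matrix.mul_apply]
    exact Finset.analyticAt_fun_sum _ fun k _ => (hH i k).mul analyticAt_const
  · rw [Matrix.det_mul, hHdet, hC₀, one_mul]
  · filter_upwards [hexp, hfg, hfk, hfp, hpq] with z he h1 h2 h3 h4 hcut
    have hzs : z ≠ s := cutPlane_subset s hcut
    have hzs' : z - s ≠ 0 := sub_ne_zero.mpr hzs
    rw [he hcut, hRdef, evalAt_mul (regularAt_removalFactor a hzs) (regularAt_map_C z _),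
      evalAt_map_C, evalAt_removalFactor a hzs, ← Matrix.mul_assoc]
    congr 1
    have hassoc : ∀ M D : Mat3, M * (P s)⁻¹ * (P z * D) = M * (f z * D) := fun M D => by
      simp only [hf, Matrix.mul_assoc]
    rw [hassoc]
    have hp' : p z = (z - s) * q z + a * f z 2 2 := by linear_combination h4
    ext i j
    fin_cases i <;> fin_cases j <;>
      simp [H, Matrix.mul_apply, Fin.sum_univ_three, Matrix.diagonal_apply] <;>
      (try simp only [h1, h2, h3, hp']) <;> field_simp <;> (try ring)

/-! ### The deformation equation -/

theorem det_one_add_Xi (κ₁ κ₂ κ₃ x y : ℂ) :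
    (1 + x • Xi κ₁ κ₂ κ₃ + y • Xi κ₁ κ₂ κ₃ ^ 2).det = 1 := by
  simp [Xi, sq, Matrix.det_fin_three]

theorem hasDerivAt_exp_log_Xi (κ₁ κ₂ κ₃ : ℂ) {t z : ℂ} (hz : z ∈ cutPlane t) (i j : Fin 3) :
    HasDerivAt (fun s => NormedSpace.exp (Complex.log (z - s) • Xi κ₁ κ₂ κ₃) i j)
      ((-(z - t)⁻¹ • (Xi κ₁ κ₂ κ₃ *
        NormedSpace.exp (Complex.log (z - t) • Xi κ₁ κ₂ κ₃))) i j) t := by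
  have hx : HasDerivAt (fun s => Complex.log (z - s)) (-(z - t)⁻¹) t := by
    have h := ((hasDerivAt_id t).const_sub z).clog hz
    simpa [div_eq_mul_inv] using h
  set x := Complex.log (z - t) with hxdef
  have h1 : HasDerivAt (fun s => (1 + Complex.log (z - s) • Xi κ₁ κ₂ κ₃ +
      (Complex.log (z - s) ^ 2 / 2) • Xi κ₁ κ₂ κ₃ ^ 2 : Mat3) i j)
      (-(z - t)⁻¹ * Xi κ₁ κ₂ κ₃ i j + (2 * x * -(z - t)⁻¹ / 2) * (Xi κ₁ κ₂ κ₃ ^ 2) i j) t := by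
    have h2 := ((hx.mul_const (Xi κ₁ κ₂ κ₃ i j)).const_add ((1 : Mat3) i j)).add
      (((hx.pow 2).div_const 2).mul_const ((Xi κ₁ κ₂ κ₃ ^ 2) i j))
    exact h2.congr_deriv (by simp [hxdef])
  have h3 : Xi κ₁ κ₂ κ₃ * (1 + x • Xi κ₁ κ₂ κ₃ + (x ^ 2 / 2) • Xi κ₁ κ₂ κ₃ ^ 2) =
      Xi κ₁ κ₂ κ₃ + x • Xi κ₁ κ₂ κ₃ ^ 2 := by
    rw [mul_add, mul_add, mul_one, Matrix.mul_smul, Matrix.mul_smul, ← pow_succ', ← sq,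
      Xi_pow_three, smul_zero, add_zero]
  simp only [exp_smul_Xi]
  rw [h3]
  refine h1.congr_deriv ?_
  simp only [Matrix.smul_apply, Matrix.add_apply, smul_eq_mul]
  ring

theorem hasDerivAt_diagonal_sub {t z : ℂ} (hz : z ≠ t) (i j : Fin 3) :
    HasDerivAt (fun s => Matrix.diagonal ![z - s, 1, (z - s)⁻¹] i j)
      ((-(z - t)⁻¹ • (expo * Matrix.diagonal ![z - t, 1, (z - t)⁻¹])) i j) t := by
  have hz' : z - t ≠ 0 := sub_ne_zero.mpr hz
  have h1 : HasDerivAt (fun s => z - s) (-1) t := by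
    simpa using (hasDerivAt_id t).const_sub z
  have h2 := h1.inv hz'
  fin_cases i <;> fin_cases j <;>
    simp [expo, hasDerivAt_const]
  · simpa [hz'] using h1
  · exact h2.congr_deriv (by field_simp)

/-- Near `λ = t`, the deformation equation forces
`u D Q D⁻¹ = P⁻¹ (-(A_t + Λ) P - u ∂P/∂t) + diag(1, 0, -1) + D Ξ D⁻¹`, where `u = λ - t` and
`D = diag(u, 1, 1/u)`; the logarithmic factor cancels as `Q` commutes with `Ξ`. -/
theorem conjugated_deformation {P E D V At Q Ξ Di C₀ : Mat3} {u : ℂ} (hu : u ≠ 0)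
    (hP : IsUnit P.det) (hE : E.det = 1) (hC : C₀.det = 1) (hD : D * Di = 1) (hQE : Commute Q E)
    (hDexpo : Commute D expo)
    (h : (V * D + P * (-u⁻¹ • (expo * D))) * E * C₀ + P * D * (-u⁻¹ • (Ξ * E)) * C₀ +
      P * D * E * (Q * C₀) = -(u⁻¹ • At) * (P * D * E * C₀)) :
    u • (D * Q * Di) = P⁻¹ * (-(At * P) - u • V) + expo + D * Ξ * Di := by
  have hEu : IsUnit E.det := by rw [hE]; exact isUnit_one
  have hCu : IsUnit C₀.det := by rw [hC]; exact isUnit_one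
  have h1 : (V * D + P * (-u⁻¹ • (expo * D)) + P * D * (-u⁻¹ • Ξ) + P * D * Q) * (E * C₀) =
      (-(u⁻¹ • At) * (P * D)) * (E * C₀) := by
    have h2 : P * D * E * (Q * C₀) = P * D * Q * (E * C₀) := by
      rw [← Matrix.mul_assoc (P * D * E), Matrix.mul_assoc (P * D) E Q, ← hQE.eq]
      simp only [Matrix.mul_assoc]
    have h3 : P * D * (-u⁻¹ • (Ξ * E)) * C₀ = P * D * (-u⁻¹ • Ξ) * (E * C₀) := by
      simp only [Matrix.mul_smul, Matrix.smul_mul, Matrix.mul_assoc]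
    rw [h2, h3] at h
    rw [add_mul _ (P * D * Q), add_mul _ (P * D * (-u⁻¹ • Ξ)), ← Matrix.mul_assoc _ E C₀, h]
    simp only [Matrix.mul_assoc]
  have hECu : IsUnit (E * C₀).det := by rw [Matrix.det_mul]; exact hEu.mul hCu
  have h4 := congrArg (· * (E * C₀)⁻¹) h1
  simp only [Matrix.mul_nonsing_inv_cancel_right _ _ hECu] at h4
  have h5 := congrArg (fun M => u • (M * Di)) h4
  have h6 : u • V + -(P * expo) + -(P * (D * Ξ * Di)) + P * (u • (D * Q * Di)) = -(At * P) := by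
    have e1 : expo * D = D * expo := hDexpo.eq.symm
    have e2 : V * D * Di = V := by rw [Matrix.mul_assoc, hD, mul_one]
    have e3 : P * (expo * D) * Di = P * expo := by
      rw [Matrix.mul_assoc, Matrix.mul_assoc, hD, mul_one]
    have e4 : At * (P * D) * Di = At * P := by
      rw [Matrix.mul_assoc, Matrix.mul_assoc, hD, mul_one]
    simp only [add_mul, smul_add, Matrix.mul_smul, Matrix.smul_mul, neg_smul, Matrix.neg_mul,
      Matrix.mul_neg, smul_neg, smul_smul, mul_inv_cancel₀ hu, one_smul, e2, e3, e4] at h5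
    simp only [Matrix.mul_smul, Matrix.mul_assoc] at h5 ⊢
    exact h5
  have h7 : P * (u • (D * Q * Di)) = (-(At * P) - u • V) + P * expo + P * (D * Ξ * Di) := by
    rw [← h6]; abel
  have h8 := congrArg (P⁻¹ * ·) h7
  simpa only [mul_add, Matrix.nonsing_inv_mul_cancel_left _ _ hP] using h8

theorem diagonal_mul_diagonal_inv {u : ℂ} (hu : u ≠ 0) :
    Matrix.diagonal ![u, 1, u⁻¹] * Matrix.diagonal ![u⁻¹, 1, u] = (1 : Mat3) := by
  rw [Matrix.diagonal_mul_diagonal, ← Matrix.diagonal_one]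
  congr 1
  ext i
  fin_cases i <;> simp [hu]

/-- Deformation equations with `Λ = ψ₀ (μ₁ E₂₁ + μ₂ E₃₂) ψ₀⁻¹` fix the entries of `Q` below the
diagonal: conjugation by `D = diag(u, 1, 1/u)` scales them by `1/u` and `1/u²`, and
`u D Q D⁻¹` tends to `-(μ₁ E₂₁ + μ₂ E₃₂)` as `u → 0`. -/
theorem Qmat_entries_of_deformation {Ψ : ℂ → ℂ → Mat3} {P : ℂ × ℂ → Mat3} {C : ℂ → Mat3}
    {κ₁ κ₂ κ₃ t μ₁ μ₂ : ℂ}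
    (hP : ∀ i j, AnalyticAt ℂ (fun p => P p i j) (t, t)) (hdetP : (P (t, t)).det = 1)
    (hexp : ∀ᶠ p : ℂ × ℂ in 𝓝 (t, t), p.2 ∈ cutPlane p.1 →
      Ψ p.1 p.2 = P p * Matrix.diagonal ![p.2 - p.1, 1, (p.2 - p.1)⁻¹] *
        NormedSpace.exp (Complex.log (p.2 - p.1) • Xi κ₁ κ₂ κ₃) * C p.1)
    (hC : ∀ i j, DifferentiableAt ℂ (fun s => C s i j) t) (hdetC : (C t).det = 1)
    (hcomm : Commute (Qmat C t) (Xi κ₁ κ₂ κ₃))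
    (hdef : SatisfiesDeformation Ψ t (P (t, t) * expo * (P (t, t))⁻¹) (Lam (P (t, t)) μ₁ μ₂)) :
    Qmat C t 2 0 = 0 ∧ Qmat C t 1 0 = -μ₁ ∧ Qmat C t 2 1 = -μ₂ := by
  set Q := Qmat C t with hQ
  set Ξ := Xi κ₁ κ₂ κ₃ with hΞ
  set At : Mat3 := P (t, t) * expo * (P (t, t))⁻¹ + Lam (P (t, t)) μ₁ μ₂ with hAtdef
  have hle : 𝓝[cutPlane t] t ≤ 𝓝 t := nhdsWithin_le_nhds
  have hPu : IsUnit (P (t, t)).det := by rw [hdetP]; exact isUnit_one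
  -- the partial derivative of `P` with respect to the deformation parameter
  let V : ℂ → Mat3 := fun z =>
    Matrix.of fun i j => fderiv ℂ (fun p => P p i j) (t, z) (1, 0)
  have hpair : Tendsto (fun z : ℂ => (t, z)) (𝓝 t) (𝓝 (t, t)) :=
    (Continuous.prodMk_right t).tendsto t
  have hVt : Tendsto V (𝓝[cutPlane t] t) (𝓝 (V t)) :=
    tendsto_matrix_of_entries fun i j =>
      (((hP i j).fderiv.continuousAt.clm_apply
        (continuousAt_const (y := ((1, 0) : ℂ × ℂ)))).tendsto.comp hpair).mono_left hle
  have hPt : Tendsto (fun z => P (t, z)) (𝓝[cutPlane t] t) (𝓝 (P (t, t))) :=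
    tendsto_matrix_of_entries fun i j =>
      ((hP i j).continuousAt.tendsto.comp hpair).mono_left hle
  have hPan : ∀ᶠ z in 𝓝 t, ∀ i j, AnalyticAt ℂ (fun p => P p i j) (t, z) := by
    simp only [eventually_all]
    exact fun i j => hpair.eventually (hP i j).eventually_analyticAt
  obtain ⟨hPinv, hPunit⟩ := tendsto_inv_of_det_eq_one hPt hdetP
  let D : ℂ → Mat3 := fun z => Matrix.diagonal ![z - t, 1, (z - t)⁻¹]
  let Di : ℂ → Mat3 := fun z => Matrix.diagonal ![(z - t)⁻¹, 1, z - t]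
  have hC' : (Matrix.of fun i j => deriv (fun s => C s i j) t : Mat3) = Q * C t := by
    rw [hQ, Qmat, Matrix.nonsing_inv_mul_cancel_right]
    rw [hdetC]; exact isUnit_one
  have key : ∀ᶠ z in 𝓝[cutPlane t] t, (z - t) • (D z * Q * Di z) =
      (P (t, z))⁻¹ * (-(At * P (t, z)) - (z - t) • V z) + expo + D z * Ξ * Di z := by
    filter_upwards [hle hPan, hPunit, hdef, hle (hpair.eventually hexp.eventually_nhds),
      self_mem_nhdsWithin] with z hz hu hd hev hcut
    have hzt : z ≠ t := cutPlane_subset t hcut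
    have hzt' : z - t ≠ 0 := sub_ne_zero.mpr hzt
    have hpair' : Tendsto (fun s : ℂ => (s, z)) (𝓝 t) (𝓝 (t, z)) :=
      (Continuous.prodMk_left z).tendsto t
    have hcut' : ∀ᶠ s in 𝓝 t, z ∈ cutPlane s :=
      (Complex.isOpen_slitPlane.preimage (continuous_const.sub continuous_id)).mem_nhds hcut
    have hloc : ∀ᶠ s in 𝓝 t, Ψ s z = P (s, z) * Matrix.diagonal ![z - s, 1, (z - s)⁻¹] *
        NormedSpace.exp (Complex.log (z - s) • Ξ) * C s := by
      filter_upwards [hpair'.eventually hev, hcut'] with s h1 h2 using h1 h2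
    have hdP : ∀ i j, HasDerivAt (fun s => P (s, z) i j) (V z i j) t := fun i j =>
      (hz i j).differentiableAt.hasFDerivAt.comp_hasDerivAt (f := fun s => (s, z)) t
        ((hasDerivAt_id t).prodMk (hasDerivAt_const t z))
    set E : Mat3 := NormedSpace.exp (Complex.log (z - t) • Ξ) with hE
    have hEpoly : E = 1 + Complex.log (z - t) • Ξ + (Complex.log (z - t) ^ 2 / 2) • Ξ ^ 2 :=
      exp_smul_Xi _ _ _ _
    refine conjugated_deformation (E := E) (C₀ := C t) hzt' hu (hEpoly ▸ det_one_add_Xi _ _ _ _ _)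
      hdetC (diagonal_mul_diagonal_inv hzt') ?_ ?_ ?_
    · rw [hEpoly]
      exact ((Commute.one_right _).add_right (hcomm.smul_right _)).add_right
        ((hcomm.pow_right 2).smul_right _)
    · exact Matrix.commute_diagonal _ _
    · ext i j
      have h1 := hasDerivAt_mul_entries (hasDerivAt_mul_entries (hasDerivAt_mul_entries hdP
        (hasDerivAt_diagonal_sub hzt)) (hasDerivAt_exp_log_Xi κ₁ κ₂ κ₃ hcut))
        (G' := Q * C t) (fun i j => by
          rw [← hC']
          exact (hC i j).hasDerivAt) i j
      have h2 := h1.congr_of_eventuallyEq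
        (hloc.mono fun s hs => congrArg (fun M : Mat3 => M i j) hs)
      have h3 := h2.unique (hd i j)
      rw [hloc.self_of_nhds, add_mul] at h3
      exact h3
  -- the limit of the right-hand side
  set L : Mat3 := !![0, 0, 0; μ₁, 0, 0; 0, μ₂, 0] with hL
  have hut : Tendsto (fun z : ℂ => z - t) (𝓝[cutPlane t] t) (𝓝 0) := by
    have : Tendsto (fun z : ℂ => z - t) (𝓝 t) (𝓝 (t - t)) := tendsto_id.sub_const t
    rw [sub_self] at this
    exact this.mono_left hle
  have hDXi : Tendsto (fun z => D z * Ξ * Di z) (𝓝[cutPlane t] t) (𝓝 0) := by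
    have h1 : ∀ z, D z * Ξ * Di z =
        !![0, (z - t) * κ₂, (z - t) ^ 2 * κ₁; 0, 0, (z - t) * κ₃; 0, 0, 0] := by
      intro z
      ext i j
      fin_cases i <;> fin_cases j <;>
        simp [D, Di, hΞ, Xi, Matrix.diagonal_mul, Matrix.mul_diagonal] <;> ring
    simp only [h1]
    refine tendsto_matrix_of_entries fun i j => ?_
    have hu2 := hut.pow 2
    have l1 := hut.mul_const κ₂
    have l2 := hu2.mul_const κ₁
    have l3 := hut.mul_const κ₃
    rw [zero_mul] at l1 l3
    rw [zero_pow two_ne_zero, zero_mul] at l2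
    fin_cases i <;> fin_cases j <;>
      first | exact l1 | exact l2 | exact l3 | exact tendsto_const_nhds
  have hlim : Tendsto (fun z => (z - t) • (D z * Q * Di z)) (𝓝[cutPlane t] t) (𝓝 (-L)) := by
    have h1 : Tendsto (fun z => (P (t, z))⁻¹ * (-(At * P (t, z)) - (z - t) • V z) + expo +
        D z * Ξ * Di z) (𝓝[cutPlane t] t)
        (𝓝 ((P (t, t))⁻¹ * (-(At * P (t, t)) - (0 : ℂ) • V t) + expo + 0)) :=
      ((hPinv.mul (((tendsto_const_nhds.mul hPt).neg).sub (hut.smul hVt))).add_const expo).add hDXi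
    have h2 : (P (t, t))⁻¹ * (-(At * P (t, t)) - (0 : ℂ) • V t) + expo + 0 = -L := by
      have h3 : At * P (t, t) = P (t, t) * (expo + L) := by
        rw [hAtdef, Lam, add_mul, Matrix.nonsing_inv_mul_cancel_right _ _ hPu,
          Matrix.nonsing_inv_mul_cancel_right _ _ hPu, mul_add]
      rw [h3, zero_smul, sub_zero, add_zero, Matrix.mul_neg,
        Matrix.nonsing_inv_mul_cancel_left _ _ hPu]
      abel
    rw [← h2]
    exact h1.congr' (key.mono fun z hz => hz.symm)
  have hne : ∀ᶠ z in 𝓝[cutPlane t] t, z - t ≠ 0 := by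
    filter_upwards [self_mem_nhdsWithin] with z hz
    exact sub_ne_zero.mpr (cutPlane_subset t hz)
  refine ⟨?_, ?_, ?_⟩
  · have h1 := hut.mul (tendsto_entry hlim 2 0)
    have h2 : Tendsto (fun _ : ℂ => Q 2 0) (𝓝[cutPlane t] t) (𝓝 0) := by
      rw [zero_mul] at h1
      refine h1.congr' (hne.mono fun z hz => ?_)
      simp [D, Di, Matrix.diagonal_mul, Matrix.mul_diagonal]
      field_simp
    exact tendsto_nhds_unique tendsto_const_nhds h2
  · have h2 : Tendsto (fun _ : ℂ => Q 1 0) (𝓝[cutPlane t] t) (𝓝 ((-L) 1 0)) := by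
      refine (tendsto_entry hlim 1 0).congr' (hne.mono fun z hz => ?_)
      simp [D, Di, Matrix.diagonal_mul, Matrix.mul_diagonal]
      field_simp
    simpa [hL] using tendsto_nhds_unique tendsto_const_nhds h2
  · have h2 : Tendsto (fun _ : ℂ => Q 2 1) (𝓝[cutPlane t] t) (𝓝 ((-L) 2 1)) := by
      refine (tendsto_entry hlim 2 1).congr' (hne.mono fun z hz => ?_)
      simp [D, Di, Matrix.diagonal_mul, Matrix.mul_diagonal]
      field_simp
    simpa [hL] using tendsto_nhds_unique tendsto_const_nhds h2

theorem seriesSum_self (ψ : ℂ → ℕ → Mat3) (s : ℂ) : seriesSum ψ s s = ψ s 0 := by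
  rw [seriesSum, tsum_eq_single 0 fun n hn => by simp [hn]]
  simp

end NonSchlesinger

theorem proposition2
    -- the range of the deformation parameter
    (T : Set ℂ) (hT : IsOpen T)
    -- the family of equations `dΨ/dλ = A(λ) Ψ`, with a Fuchsian singularity at `λ = t`
    (A : ℂ → RatMat3) (At : ℂ → Mat3)
    (hA : ∀ t ∈ T, HasFuchsianPole (A t) t (At t))
    -- a fundamental solution and its expansion at `λ = t`, with `Ξ` independent of `t`
    (Ψ : ℂ → ℂ → Mat3) (ψ : ℂ → ℕ → Mat3) (κ₁ κ₂ κ₃ : ℂ) (C : ℂ → Mat3)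
    (hΨ : ∀ t ∈ T, SolvesNear (A t) t (Ψ t))
    (hexp : ∀ t ∈ T, HasExpansionNear Ψ ψ (Xi κ₁ κ₂ κ₃) C t)
    (hC : ∀ i j, DifferentiableOn ℂ (fun t => C t i j) T)
    (hdetC : ∀ t ∈ T, (C t).det = 1)
    (hdetψ : ∀ t ∈ T, (ψ t 0).det = 1)
    -- the residue has eigenvalues `1, 0, -1`
    (hAt : ∀ t ∈ T, At t = ψ t 0 * expo * (ψ t 0)⁻¹)
    -- the isomonodromy condition
    (t : ℂ) (ht : t ∈ T) (hiso : IsomonodromyCondition C (Xi κ₁ κ₂ κ₃) t) :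
    -- generic situation
    ((Qmat C t 2 0 ≠ 0 ∨ (Qmat C t 2 0 = 0 ∧ Qmat C t 1 0 * Qmat C t 2 1 ≠ 0)) →
      Xi κ₁ κ₂ κ₃ = 0 ∧
      ∀ s ∈ T, ∃ R : RatMat3, IsSchlesinger s R ∧
        RegularAt s (transformed R (A s)) ∧
        ∀ z, z ≠ s → poleOrder z (transformed R (A s)) = poleOrder z (A s)) ∧
    -- degenerate situations
    (Qmat C t 2 0 = 0 → Qmat C t 2 1 = 0 → Qmat C t 1 0 ≠ 0 → κ₂ = 0) ∧
    (Qmat C t 2 0 = 0 → Qmat C t 1 0 = 0 → Qmat C t 2 1 ≠ 0 → κ₃ = 0) ∧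
    -- the meaning of these entries of `Q` for a deformation with the coefficients `μ₁, μ₂`
    (∀ μ₁ μ₂ : ℂ, SatisfiesDeformation Ψ t (At t) (Lam (ψ t 0) μ₁ μ₂) →
      Qmat C t 2 0 = 0 ∧ Qmat C t 1 0 = -μ₁ ∧ Qmat C t 2 1 = -μ₂) := by
  have hcomm := hiso.commute
  obtain ⟨e1, e2, e3, e4, -⟩ := entries_of_commute_Xi hcomm
  refine ⟨fun hQ => ?_, fun h20 _ h10 => ?_, fun h20 _ h21 => ?_, fun μ₁ μ₂ hdef => ?_⟩
  · have hXi : Xi κ₁ κ₂ κ₃ = 0 := Xi_eq_zero_of_commute hcomm hQ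
    refine ⟨hXi, fun s hs => ?_⟩
    obtain ⟨han, hev⟩ := hexp s hs
    have hpair : Tendsto (fun z : ℂ => (s, z)) (𝓝 s) (𝓝 (s, s)) :=
      (Continuous.prodMk_right s).tendsto s
    refine exists_removing_schlesinger (P := seriesSum ψ s) (C₀ := C s) (hΨ s hs) (fun i j => ?_)
      (by rw [seriesSum_self, hdetψ s hs]) (hdetC s hs) ?_
    · exact (han i j).comp_of_eq (analyticAt_const.prod analyticAt_id) rfl
    · filter_upwards [hpair.eventually hev] with z hz hcut
      have h := hz.2 hcut
      rw [hXi, smul_zero, NormedSpace.exp_zero, mul_one] at h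
      exact h
  · rw [h20, mul_zero, add_zero] at e4
    exact (mul_eq_zero.mp e4).resolve_right h10
  · rw [h20, mul_zero, zero_add] at e3
    exact (mul_eq_zero.mp e3).resolve_right h21
  · obtain ⟨han, hev⟩ := hexp t ht
    rw [hAt t ht] at hdef
    refine Qmat_entries_of_deformation (Ψ := Ψ) (P := fun p => seriesSum ψ p.1 p.2) han ?_
      (hev.mono fun p hp => hp.2)
      (fun i j => (hC i j).differentiableAt (hT.mem_nhds ht)) (hdetC t ht) hcomm ?_
    · rw [seriesSum_self, hdetψ t ht]
    · simpa only [seriesSum_self] using hdef
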